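/- Theorem (Malcev Uniqueness Theorem). Let $k$ be a field, regarded as a discrete topological ring, and let $A$ be a pseudocompact $k$-algebra, that is, an associative unital topological $k$-algebra which has a basis of neighbourhoods of $0$ consisting of two-sided ideals of finite codimension whose intersection is $0$, and which is complete. Let $J = J(A)$ be the Jacobson radical of $A$, that is, the intersection of the maximal closed left ideals of $A$; it is a two-sided ideal. Suppose that the algebra $A/J$ (with the quotient topology) is separable, meaning that for every finite extension field $E$ of $k$ the completed tensor product $(A/J)\,\widehat{\otimes}_k\,E$ is topologically semisimple: each of its closed left ideals has a closed left ideal as a complement. Here $B\,\widehat{\otimes}_k\,C$ is the inverse limit of the discrete algebras $B/I\otimes_k C/K$, where $I$ and $K$ run over the open two-sided ideals of finite codimension of $B$ and of $C$, and $E$ is discrete. Let $S_1, S_2$ be two closed unital subalgebras of $A$ such that $$S_1\oplus J = A = S_2\oplus J$$ as vector spaces. Then there is $\omega\in J$ such that $1-\omega$ is invertible in $A$ and $$S_1 = (1-\omega)\,S_2\,(1-\omega)^{-1}.$$ -/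

import Mathlib

open Topology TensorProduct

universe u v w

/-- An open two-sided ideal of finite codimension in a `k`-algebra `A` carrying a topology. -/
structure OpenIdeal (k : Type u) (A : Type v) [Field k] [Ring A] [Algebra k A]
    [TopologicalSpace A] where
  toIdeal : Ideal A
  isTwoSided : toIdeal.IsTwoSided
  isOpen : IsOpen (toIdeal : Set A)
  finiteDimensional : FiniteDimensional k (A ⧸ toIdeal)

instance OpenIdeal.instIsTwoSided {k : Type u} {A : Type v} [Field k] [Ring A] [Algebra k A]
    [TopologicalSpace A] (I : OpenIdeal k A) : I.toIdeal.IsTwoSided :=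
  I.isTwoSided

/-- A pseudocompact `k`-algebra: a topological `k`-algebra (`k` discrete, so that continuity of
the scalar multiplication follows from continuity of the multiplication of `A`) having a basis of
neighbourhoods of `0` consisting of two-sided ideals of finite codimension, whose intersection
is `0`, and which is complete. -/
class IsPseudocompactAlgebra (k : Type u) (A : Type v) [Field k] [Ring A] [Algebra k A]
    [TopologicalSpace A] : Prop extends IsTopologicalRing A where
  hasBasis_nhds_zero :
    (𝓝 (0 : A)).HasBasis (fun _ : OpenIdeal k A => True) (fun I => (I.toIdeal : Set A))
  iInf_openIdeal_eq_bot : (⨅ I : OpenIdeal k A, I.toIdeal) = ⊥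
  complete : @CompleteSpace A (IsTopologicalAddGroup.rightUniformSpace A)

/-- `M` is a maximal closed left ideal: maximal among the proper closed left ideals. -/
def IsMaximalClosedLeftIdeal {A : Type v} [Ring A] [TopologicalSpace A] (M : Ideal A) : Prop :=
  Maximal (fun L : Ideal A => IsClosed (L : Set A) ∧ L ≠ ⊤) M

/-- The topological Jacobson radical `J(A)` of a `k`-algebra `A`: the intersection of its maximal
closed left ideals. -/
def topJacobson (k : Type u) (A : Type v) [Field k] [Ring A] [Algebra k A]
    [TopologicalSpace A] : Ideal A :=
  sInf {M : Ideal A | IsMaximalClosedLeftIdeal M}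

/-- In a pseudocompact algebra, a maximal closed left ideal is open. -/
theorem IsMaximalClosedLeftIdeal.isOpen (k : Type u) {A : Type v} [Field k] [Ring A] [Algebra k A]
    [TopologicalSpace A] [IsPseudocompactAlgebra k A] {M : Ideal A}
    (hM : IsMaximalClosedLeftIdeal M) : IsOpen (M : Set A) := by
  have h1 : (1 : A) ∈ (M : Set A)ᶜ := fun h => hM.prop.2 ((Ideal.eq_top_iff_one M).2 h)
  have h2 : (fun x : A => 1 + x) ⁻¹' (M : Set A)ᶜ ∈ 𝓝 (0 : A) :=
    (hM.prop.1.isOpen_compl.preimage (continuous_const.add continuous_id)).mem_nhds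
      (by simpa using h1)
  obtain ⟨I, -, hI⟩ := (IsPseudocompactAlgebra.hasBasis_nhds_zero (k := k) (A := A)).mem_iff.1 h2
  have hopen : IsOpen ((M ⊔ I.toIdeal : Ideal A) : Set A) :=
    AddSubgroup.isOpen_mono (H₁ := I.toIdeal.toAddSubgroup)
      (H₂ := (M ⊔ I.toIdeal).toAddSubgroup) (fun x hx => Ideal.mem_sup_right hx) I.isOpen
  have hclosed : IsClosed ((M ⊔ I.toIdeal : Ideal A) : Set A) :=
    AddSubgroup.isClosed_of_isOpen (M ⊔ I.toIdeal).toAddSubgroup hopen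
  have hne : M ⊔ I.toIdeal ≠ ⊤ := by
    intro h
    obtain ⟨m, hm, i, hi, hmi⟩ := Submodule.mem_sup.1 ((Ideal.eq_top_iff_one _).1 h)
    refine hI (I.toIdeal.neg_mem hi) ?_
    have : (1 : A) + -i = m := by rw [← hmi]; abel
    simpa [this] using hm
  have : M ⊔ I.toIdeal ≤ M := hM.le_of_ge ⟨hclosed, hne⟩ le_sup_left
  rwa [le_antisymm this le_sup_left] at hopen

/-- In a pseudocompact algebra, a maximal closed left ideal is a maximal left ideal. -/
theorem IsMaximalClosedLeftIdeal.isMaximal (k : Type u) {A : Type v} [Field k] [Ring A]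
    [Algebra k A] [TopologicalSpace A] [IsPseudocompactAlgebra k A] {M : Ideal A}
    (hM : IsMaximalClosedLeftIdeal M) : M.IsMaximal := by
  refine ⟨⟨hM.prop.2, fun L hL => ?_⟩⟩
  by_contra hne
  have hopen : IsOpen (L : Set A) :=
    AddSubgroup.isOpen_mono (H₁ := M.toAddSubgroup) (H₂ := L.toAddSubgroup) hL.le (hM.isOpen k)
  exact hL.not_ge (hM.le_of_ge ⟨AddSubgroup.isClosed_of_isOpen L.toAddSubgroup hopen, hne⟩ hL.le)

/-- The radical of a pseudocompact algebra is a two-sided ideal. -/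
instance topJacobson.instIsTwoSided (k : Type u) (A : Type v) [Field k] [Ring A] [Algebra k A]
    [TopologicalSpace A] [IsPseudocompactAlgebra k A] : (topJacobson k A).IsTwoSided := by
  refine ⟨fun {x} a hx => ?_⟩
  refine Submodule.mem_sInf.2 fun M hM => ?_
  replace hM : IsMaximalClosedLeftIdeal M := hM
  by_cases ha : a ∈ M
  · exact Ideal.mul_mem_left M x ha
  -- the left ideal `(M : a) = {y | y * a ∈ M}`
  let f : A →ₗ[A] A := LinearMap.toSpanSingleton A A a
  let N : Ideal A := Submodule.comap f M
  have hmem : ∀ y, y ∈ N ↔ y * a ∈ M := fun y => Iff.rfl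
  suffices hN : IsMaximalClosedLeftIdeal N from (hmem x).1 (Submodule.mem_sInf.1 hx N hN)
  have hcl : IsClosed (N : Set A) := hM.prop.1.preimage (continuous_id.mul continuous_const)
  refine ⟨⟨hcl, fun h => ha ?_⟩, fun L hL hNL y hy => ?_⟩
  · simpa using (hmem 1).1 (h ▸ Submodule.mem_top)
  · by_contra hyN
    have hlt : M < M ⊔ Ideal.span {y * a} := lt_of_le_of_ne le_sup_left fun h =>
      hyN ((hmem y).2 (h ▸ Ideal.mem_sup_right (Ideal.mem_span_singleton_self _)))
    have htop := (IsMaximalClosedLeftIdeal.isMaximal k hM).1.2 _ hlt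
    have hamem : a ∈ M ⊔ Ideal.span {y * a} := htop ▸ Submodule.mem_top
    obtain ⟨m, hm, z, hz, hmz⟩ := Submodule.mem_sup.1 hamem
    obtain ⟨r, rfl⟩ := Ideal.mem_span_singleton'.1 hz
    have h1 : 1 - r * y ∈ N := by
      refine (hmem _).2 ?_
      have : (1 - r * y) * a = m := by
        rw [sub_mul, one_mul, mul_assoc, sub_eq_iff_eq_add]; exact hmz.symm
      rwa [this]
    refine hL.2 ((Ideal.eq_top_iff_one L).2 ?_)
    have := L.add_mem (hNL h1) (L.mul_mem_left r hy)
    simpa using this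

/-- The transition map `A/I ⊗ B/K → A/I' ⊗ B/K'` for open ideals `I ⊆ I'` of `A` and `K ⊆ K'`
of `B`. -/
noncomputable def OpenIdeal.tensorTransition {k : Type u} {A : Type v} {B : Type w} [Field k]
    [Ring A] [Algebra k A] [TopologicalSpace A] [Ring B] [Algebra k B] [TopologicalSpace B]
    {I I' : OpenIdeal k A} {K K' : OpenIdeal k B}
    (h : I.toIdeal ≤ I'.toIdeal) (h' : K.toIdeal ≤ K'.toIdeal) :
    (A ⧸ I.toIdeal) ⊗[k] (B ⧸ K.toIdeal) →ₐ[k] (A ⧸ I'.toIdeal) ⊗[k] (B ⧸ K'.toIdeal) :=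
  Algebra.TensorProduct.map (Ideal.Quotient.factorₐ k h) (Ideal.Quotient.factorₐ k h')

/-- The inverse limit of the algebras `A/I ⊗ B/K`, as a subalgebra of their product. -/
noncomputable def completedTensorSubalgebra (k : Type u) (A : Type v) (B : Type w) [Field k]
    [Ring A] [Algebra k A] [TopologicalSpace A] [Ring B] [Algebra k B] [TopologicalSpace B] :
    Subalgebra k (∀ p : OpenIdeal k A × OpenIdeal k B,
      (A ⧸ p.1.toIdeal) ⊗[k] (B ⧸ p.2.toIdeal)) where
  carrier := {x | ∀ (p q : OpenIdeal k A × OpenIdeal k B) (h : p.1.toIdeal ≤ q.1.toIdeal)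
    (h' : p.2.toIdeal ≤ q.2.toIdeal), OpenIdeal.tensorTransition h h' (x p) = x q}
  mul_mem' hx hy p q h h' := by simp [hx p q h h', hy p q h h']
  add_mem' hx hy p q h h' := by simp [hx p q h h', hy p q h h']
  algebraMap_mem' r p q h h' := (OpenIdeal.tensorTransition h h').commutes r

/-- The completed tensor product `A ⊗̂ B` over `k` of (pseudocompact) `k`-algebras `A` and `B`:
the inverse limit of the discrete algebras `A/I ⊗ B/K`, where `I` and `K` run over the open
ideals of `A` and `B`. -/
def CompletedTensor (k : Type u) (A : Type v) (B : Type w) [Field k]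
    [Ring A] [Algebra k A] [TopologicalSpace A] [Ring B] [Algebra k B] [TopologicalSpace B] :
    Type (max v w) :=
  completedTensorSubalgebra k A B

section CompletedTensor

variable (k : Type u) (A : Type v) (B : Type w) [Field k]
    [Ring A] [Algebra k A] [TopologicalSpace A] [Ring B] [Algebra k B] [TopologicalSpace B]

noncomputable instance CompletedTensor.instRing : Ring (CompletedTensor k A B) :=
  inferInstanceAs (Ring (completedTensorSubalgebra k A B))

noncomputable instance CompletedTensor.instAlgebra : Algebra k (CompletedTensor k A B) :=
  inferInstanceAs (Algebra k (completedTensorSubalgebra k A B))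

/-- The inverse limit topology: the topology induced by the product topology, where every factor
`A/I ⊗ B/K` is discrete. -/
instance CompletedTensor.instTopologicalSpace : TopologicalSpace (CompletedTensor k A B) :=
  TopologicalSpace.induced
    (Subtype.val : completedTensorSubalgebra k A B →
      ∀ p : OpenIdeal k A × OpenIdeal k B, (A ⧸ p.1.toIdeal) ⊗[k] (B ⧸ p.2.toIdeal))
    (@Pi.topologicalSpace _ _ (fun _ => ⊥))

end CompletedTensor

/-- A topological algebra is (left) topologically semisimple if every closed left ideal has a
closed left ideal as a complement. (Left ideals of a unital algebra are subspaces, so this only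
involves the ring structure and the topology.) -/
def IsTopologicallySemisimple (R : Type v) [Ring R] [TopologicalSpace R] : Prop :=
  ∀ I : Ideal R, IsClosed (I : Set R) → ∃ L : Ideal R, IsClosed (L : Set R) ∧ IsCompl I L

/-- A pseudocompact `k`-algebra `B` is separable if `B ⊗̂ E` is topologically semisimple for every
finite extension field `E` of `k` (with the discrete topology). Every finite extension of `k` is
isomorphic to one in the universe of `k`. -/
def IsSeparablePseudocompact (k : Type u) (B : Type v) [Field k] [Ring B] [Algebra k B]
    [TopologicalSpace B] : Prop :=
  ∀ (E : Type u) [Field E] [Algebra k E] [FiniteDimensional k E] [TopologicalSpace E]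
    [DiscreteTopology E], IsTopologicallySemisimple (CompletedTensor k B E)

/-!
The subalgebras `S₁` and `S₂` are the images of two sections `σ, τ : A/J → A` of the projection, and
it suffices to find `c ∈ 1 + J` with `σ x * c = c * τ x` for all `x`.

If `B` is a finite-dimensional algebra with a separability idempotent `e = ∑ xᵢ ⊗ yᵢ`, and
`f, g : B → C` are homomorphisms, then `c = ∑ f xᵢ * g yᵢ` satisfies `f b * c = c * g b`, and `c`
becomes `1` wherever `f` and `g` become equal. This is applied to the homomorphisms induced by `σ`
and `τ` from a discrete finite-dimensional quotient `B` of `A/J` to `C = A/I`, for each open ideal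
`I`. The idempotent exists (`IsSeparablePseudocompact.exists_isSeparabilityIdempotent`) because all
`E ⊗ B` with `E/k` finite are semisimple, as quotients of the completed tensor products; then so is
the scalar extension to an algebraic closure `K`, which is therefore a product of matrix algebras,
whose separability idempotent descends along a `k`-linear retraction `K → k`.

The passage from the algebras `A/I` to `A` rests on linear compactness
(`IsPseudocompactAlgebra.exists_forall_mem`): a directed family of nonempty closed affine subspaces
of `A` has a common point. By Zorn's lemma there is a minimal filter with a basis of affine
subspaces below the one generated by the family; minimality makes it Cauchy, and its limit is a
common point. Linear compactness yields the common intertwiner `c`, the invertibility of the elements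
of `1 + J`, and the continuity of `σ` and `τ`: the subspaces `(Sᵢ ∩ I) + J` are closed and of finite
codimension, hence open.
-/

/-! ### Separability idempotents -/

/-- An element `e = ∑ xᵢ ⊗ yᵢ` of `B ⊗ B` is a separability idempotent of the `k`-algebra `B` if
`∑ xᵢ yᵢ = 1` and `∑ b xᵢ ⊗ yᵢ = ∑ xᵢ ⊗ yᵢ b` for all `b`. -/
structure IsSeparabilityIdempotent (k : Type u) {B : Type v} [CommRing k] [Ring B] [Algebra k B]
    (e : B ⊗[k] B) : Prop where
  mul'_eq_one : LinearMap.mul' k B e = 1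
  rTensor_eq_lTensor : ∀ b : B,
    (LinearMap.mulLeft k b).rTensor B e = (LinearMap.mulRight k b).lTensor B e

namespace IsSeparabilityIdempotent

theorem matrix (k : Type u) [CommRing k] (n : Type v) [Fintype n] [DecidableEq n] (o : n) :
    IsSeparabilityIdempotent k (∑ i : n,
      (Matrix.single i o 1 : Matrix n n k) ⊗ₜ[k] (Matrix.single o i 1 : Matrix n n k)) := by
  refine ⟨?_, fun b => ?_⟩
  · simp [Matrix.sum_single_one]
  · have h1 : ∀ i, b * Matrix.single i o (1 : k) = ∑ j, b j i • Matrix.single j o (1 : k) := by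
      intro i
      ext p q
      simp [Matrix.mul_apply, Matrix.sum_apply, Matrix.single_apply]
      by_cases h : o = q <;> simp [h]
    have h2 : ∀ i, Matrix.single o i (1 : k) * b = ∑ j, b i j • Matrix.single o j (1 : k) := by
      intro i
      ext p q
      simp [Matrix.mul_apply, Matrix.sum_apply, Matrix.single_apply]
      by_cases h : o = p <;> simp [h]
    simp only [map_sum, LinearMap.rTensor_tmul, LinearMap.lTensor_tmul, LinearMap.mulLeft_apply,
      LinearMap.mulRight_apply, h1, h2, TensorProduct.sum_tmul, TensorProduct.tmul_sum,
      TensorProduct.smul_tmul', TensorProduct.tmul_smul]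
    exact Finset.sum_comm

theorem pi {k : Type u} [CommRing k] {ι : Type w} [Fintype ι] [DecidableEq ι] {B : ι → Type v}
    [∀ i, Ring (B i)] [∀ i, Algebra k (B i)] {e : ∀ i, B i ⊗[k] B i}
    (he : ∀ i, IsSeparabilityIdempotent k (e i)) :
    IsSeparabilityIdempotent k (∑ i,
      TensorProduct.map (LinearMap.single k B i) (LinearMap.single k B i) (e i)) := by
  refine ⟨?_, fun b => ?_⟩
  · have h : ∀ i, LinearMap.mul' k (∀ i, B i) ∘ₗ
        TensorProduct.map (LinearMap.single k B i) (LinearMap.single k B i) =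
        LinearMap.single k B i ∘ₗ LinearMap.mul' k (B i) := by
      intro i
      ext x y : 3
      simp [Pi.single_mul]
    have h' := fun i => LinearMap.congr_fun (h i) (e i)
    simp only [LinearMap.comp_apply] at h'
    simp only [map_sum, h', (he _).mul'_eq_one]
    exact LinearMap.sum_single_apply B 1
  · rw [map_sum, map_sum]
    refine Finset.sum_congr rfl fun i _ => ?_
    have hl : LinearMap.mulLeft k b ∘ₗ LinearMap.single k B i =
        LinearMap.single k B i ∘ₗ LinearMap.mulLeft k (b i) := by
      ext x : 1
      simp [Pi.single_mul_right]
    have hr : LinearMap.mulRight k b ∘ₗ LinearMap.single k B i =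
        LinearMap.single k B i ∘ₗ LinearMap.mulRight k (b i) := by
      ext x : 1
      simp [Pi.single_mul_left]
    have := (he i).rTensor_eq_lTensor (b i)
    rw [← LinearMap.comp_apply, ← LinearMap.comp_apply, LinearMap.rTensor_comp_map,
      LinearMap.lTensor_comp_map, hl, hr, ← LinearMap.map_comp_rTensor,
      ← LinearMap.map_comp_lTensor, LinearMap.comp_apply, LinearMap.comp_apply, this]

theorem map_algEquiv {k : Type u} [CommRing k] {B : Type v} {C : Type w} [Ring B] [Algebra k B]
    [Ring C] [Algebra k C] {e : B ⊗[k] B} (he : IsSeparabilityIdempotent k e) (f : B ≃ₐ[k] C) :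
    IsSeparabilityIdempotent k
      (TensorProduct.map f.toLinearMap f.toLinearMap e) := by
  refine ⟨?_, fun c => ?_⟩
  · have h : LinearMap.mul' k C ∘ₗ TensorProduct.map f.toLinearMap f.toLinearMap =
        f.toLinearMap ∘ₗ LinearMap.mul' k B := by
      ext x y
      simp
    rw [← LinearMap.comp_apply, h, LinearMap.comp_apply, he.mul'_eq_one]
    simp
  · have hl : LinearMap.mulLeft k c ∘ₗ f.toLinearMap =
        f.toLinearMap ∘ₗ LinearMap.mulLeft k (f.symm c) := by
      ext x
      simp
    have hr : LinearMap.mulRight k c ∘ₗ f.toLinearMap =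
        f.toLinearMap ∘ₗ LinearMap.mulRight k (f.symm c) := by
      ext x
      simp
    rw [← LinearMap.comp_apply, ← LinearMap.comp_apply, LinearMap.rTensor_comp_map,
      LinearMap.lTensor_comp_map, hl, hr, ← LinearMap.map_comp_rTensor,
      ← LinearMap.map_comp_lTensor, LinearMap.comp_apply, LinearMap.comp_apply,
      he.rTensor_eq_lTensor]

/-- Separability descends along field extensions: a `k`-linear retraction `K → k` carries a
separability idempotent of `K ⊗ B` over `K` to one of `B` over `k`. -/
theorem descend {k : Type u} {K : Type w} {B : Type v} [Field k] [Field K] [Algebra k K] [Ring B]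
    [Algebra k B] {e : (K ⊗[k] B) ⊗[K] (K ⊗[k] B)} (he : IsSeparabilityIdempotent K e) :
    ∃ e' : B ⊗[k] B, IsSeparabilityIdempotent k e' := by
  obtain ⟨ρ, hρ⟩ := (Algebra.linearMap k K).exists_leftInverse_of_injective
    (LinearMap.ker_eq_bot.2 (algebraMap k K).injective)
  have hρ1 : ρ 1 = 1 := by simpa using LinearMap.congr_fun hρ 1
  let d := (TensorProduct.AlgebraTensorModule.distribBaseChange k K B B).symm
  let r (M : Type v) [AddCommGroup M] [Module k M] : K ⊗[k] M →ₗ[k] M :=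
    (TensorProduct.lid k M).toLinearMap ∘ₗ ρ.rTensor M
  have hr : ∀ (M : Type v) [AddCommGroup M] [Module k M] (a : K) (m : M),
      r M (a ⊗ₜ m) = ρ a • m := fun M _ _ a m => by simp [r]
  -- induction on elements of the double tensor product, from products of pure tensors
  have key : ∀ (P : (K ⊗[k] B) ⊗[K] (K ⊗[k] B) → Prop), P 0 → (∀ x y, P x → P y → P (x + y)) →
      (∀ a x b y, P ((a ⊗ₜ x) ⊗ₜ (b ⊗ₜ y))) → ∀ t, P t := by
    intro P h0 hadd ht t
    induction t using TensorProduct.induction_on with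
    | zero => exact h0
    | add x y hx hy => exact hadd x y hx hy
    | tmul x y =>
      induction x using TensorProduct.induction_on with
      | zero => simpa using h0
      | add x x' hx hx' => rw [TensorProduct.add_tmul]; exact hadd _ _ hx hx'
      | tmul a x =>
        induction y using TensorProduct.induction_on with
        | zero => simpa using h0
        | add y y' hy hy' => rw [TensorProduct.tmul_add]; exact hadd _ _ hy hy'
        | tmul b y => exact ht a x b y
  refine ⟨r _ (d e), ?_, fun b => ?_⟩
  · have : ∀ t, LinearMap.mul' k B (r _ (d t)) = r B (LinearMap.mul' K (K ⊗[k] B) t) := by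
      refine key _ (by simp) (fun x y hx hy => by simp only [map_add, hx, hy]) fun a x b y => ?_
      simp [d, hr]
    rw [this, he.mul'_eq_one, Algebra.TensorProduct.one_def, hr, hρ1, one_smul]
  · have hl : ∀ t, (LinearMap.mulLeft k b).rTensor B (r _ (d t)) =
        r _ (d ((LinearMap.mulLeft K ((1 : K) ⊗ₜ[k] b)).rTensor (K ⊗[k] B) t)) := by
      refine key _ (by simp) (fun x y hx hy => by simp only [map_add, hx, hy]) fun a x b y => ?_
      simp [d, hr]
    have hr' : ∀ t, (LinearMap.mulRight k b).lTensor B (r _ (d t)) =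
        r _ (d ((LinearMap.mulRight K ((1 : K) ⊗ₜ[k] b)).lTensor (K ⊗[k] B) t)) := by
      refine key _ (by simp) (fun x y hx hy => by simp only [map_add, hx, hy]) fun a x b y => ?_
      simp [d, hr]
    rw [hl, hr', he.rTensor_eq_lTensor]

end IsSeparabilityIdempotent

/-! ### Separability of finite-dimensional algebras -/

/-- A finite-dimensional semisimple algebra over an algebraically closed field is a product of
matrix algebras, hence has a separability idempotent. -/
theorem exists_isSeparabilityIdempotent_of_isAlgClosed (K : Type u) (B : Type v) [Field K]
    [IsAlgClosed K] [Ring B] [Algebra K B] [FiniteDimensional K B] [IsSemisimpleRing B] :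
    ∃ e : B ⊗[K] B, IsSeparabilityIdempotent K e := by
  obtain ⟨n, d, hd, ⟨f⟩⟩ := IsSemisimpleRing.exists_algEquiv_pi_matrix_of_isAlgClosed K B
  exact ⟨_, (IsSeparabilityIdempotent.pi fun i : Fin n =>
    IsSeparabilityIdempotent.matrix K (Fin (d i)) 0).map_algEquiv f.symm⟩

theorem exists_intermediateField_mem_range_map (k : Type u) (K : Type w) (B : Type v) [Field k]
    [Field K] [Algebra k K] [Algebra.IsAlgebraic k K] [Ring B] [Algebra k B] (x : K ⊗[k] B) :
    ∃ E : IntermediateField k K, FiniteDimensional k E ∧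
      x ∈ (Algebra.TensorProduct.map E.val (AlgHom.id k B)).range := by
  have mono : ∀ {E F : IntermediateField k K}, E ≤ F →
      (Algebra.TensorProduct.map E.val (AlgHom.id k B)).range ≤
      (Algebra.TensorProduct.map F.val (AlgHom.id k B)).range := by
    rintro E F h _ ⟨y, rfl⟩
    refine ⟨Algebra.TensorProduct.map (IntermediateField.inclusion h) (AlgHom.id k B) y, ?_⟩
    induction y using TensorProduct.induction_on with
    | zero => simp
    | add y z hy hz => simp only [map_add, hy, hz]
    | tmul a b => simp
  induction x using TensorProduct.induction_on with
  | zero => exact ⟨⊥, inferInstance, zero_mem _⟩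
  | tmul a b =>
    refine ⟨IntermediateField.adjoin k {a}, IntermediateField.adjoin.finiteDimensional
      (Algebra.IsIntegral.isIntegral a),
      ⟨a, IntermediateField.mem_adjoin_simple_self k a⟩ ⊗ₜ b, ?_⟩
    simp
  | add x y hx hy =>
    obtain ⟨E, hE, hx⟩ := hx
    obtain ⟨F, hF, hy⟩ := hy
    exact ⟨E ⊔ F, IntermediateField.finiteDimensional_sup E F,
      add_mem (mono le_sup_left hx) (mono le_sup_right hy)⟩

/-- If `E ⊗ B` is semisimple for all finite subextensions `E` of an algebraic extension `K`, then
so is `K ⊗ B`: an element of the (nilpotent) radical of `K ⊗ B` comes from some `E ⊗ B`, where it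
generates a nil left ideal. -/
theorem isSemisimpleRing_tensorProduct_of_isAlgebraic (k : Type u) (K : Type w) (B : Type v)
    [Field k] [Field K] [Algebra k K] [Algebra.IsAlgebraic k K] [Ring B] [Algebra k B]
    [FiniteDimensional k B]
    (h : ∀ E : IntermediateField k K, FiniteDimensional k E → IsSemisimpleRing (E ⊗[k] B)) :
    IsSemisimpleRing (K ⊗[k] B) := by
  have : IsArtinianRing (K ⊗[k] B) := IsArtinianRing.of_finite K _
  rw [IsArtinianRing.isSemisimpleRing_iff_jacobson, eq_bot_iff]
  intro x hx
  obtain ⟨n, hn⟩ := IsArtinianRing.isNilpotent_jacobson_bot (R := K ⊗[k] B)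
  obtain ⟨E, hE, y, rfl⟩ := exists_intermediateField_mem_range_map k K B x
  have := h E hE
  have hinj : Function.Injective (Algebra.TensorProduct.map E.val (AlgHom.id k B)) :=
    Module.Flat.rTensor_preserves_injective_linearMap (M := B) E.val.toLinearMap
      E.val.injective
  have hy : y ∈ Ring.jacobson (E ⊗[k] B) := by
    rw [← Ideal.jacobson_bot, Ideal.mem_jacobson_iff]
    intro z
    have hnil : IsNilpotent (z * y) := by
      refine ⟨n, hinj ?_⟩
      have h1 := Ideal.pow_mem_pow (Ideal.mul_mem_left _
        (Algebra.TensorProduct.map E.val (AlgHom.id k B) z)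
        (Ideal.jacobson_bot (R := K ⊗[k] B) ▸ hx)) n
      rw [hn] at h1
      simpa using h1
    obtain ⟨w, hw⟩ := (isUnit_iff_exists_inv'.1 hnil.isUnit_one_add)
    refine ⟨w, ?_⟩
    rw [Ideal.mem_bot, ← hw]
    noncomm_ring
  rw [IsArtinianRing.isSemisimpleRing_iff_jacobson.1 this] at hy
  rw [Ideal.mem_bot] at hy ⊢
  simp [hy]

theorem exists_isSeparabilityIdempotent (k : Type u) (B : Type v) [Field k] [Ring B] [Algebra k B]
    [FiniteDimensional k B]
    (h : ∀ (E : Type u) [Field E] [Algebra k E] [FiniteDimensional k E],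
      IsSemisimpleRing (E ⊗[k] B)) :
    ∃ e : B ⊗[k] B, IsSeparabilityIdempotent k e := by
  have := isSemisimpleRing_tensorProduct_of_isAlgebraic k (AlgebraicClosure k) B
    fun E _ => h E
  obtain ⟨e, he⟩ := exists_isSeparabilityIdempotent_of_isAlgClosed (AlgebraicClosure k)
    (AlgebraicClosure k ⊗[k] B)
  exact he.descend

/-! ### Linear compactness -/

/-- A filter on a vector space with a basis of affine subspaces. -/
def HasAffineBasis (k : Type u) {V : Type v} [Field k] [AddCommGroup V] [Module k V]
    (l : Filter V) : Prop :=
  ∀ s ∈ l, ∃ t : AffineSubspace k V, (t : Set V) ∈ l ∧ (t : Set V) ⊆ s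

/-- Zorn's lemma: infima of chains of proper filters with affine bases are again such filters. -/
theorem exists_minimal_hasAffineBasis {k : Type u} {V : Type v} [Field k] [AddCommGroup V]
    [Module k V] {l : Filter V} (hl : HasAffineBasis k l) (hne : l.NeBot) :
    ∃ m ≤ l, m.NeBot ∧ HasAffineBasis k m ∧
      ∀ m' ≤ m, m'.NeBot → HasAffineBasis k m' → m ≤ m' := by
  obtain ⟨m, hml, hm⟩ := zorn_le_nonempty₀ (α := (Filter V)ᵒᵈ)
    {m | (OrderDual.ofDual m).NeBot ∧ HasAffineBasis k (OrderDual.ofDual m)} (by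
      intro c hc hchain y hy
      have hdir : DirectedOn (· ≥ ·) (OrderDual.toDual ⁻¹' c : Set (Filter V)) :=
        IsChain.directedOn (r := (· ≥ ·)) hchain
      refine ⟨OrderDual.toDual (sInf (OrderDual.toDual ⁻¹' c)), ⟨?_, ?_⟩,
        fun z hz => sInf_le (show OrderDual.ofDual z ∈ OrderDual.toDual ⁻¹' c from hz)⟩
      · exact Filter.sInf_neBot_of_directed' ⟨OrderDual.ofDual y, hy⟩ hdir
          fun h => (hc h).1.ne rfl
      · intro s hs
        obtain ⟨m, hmc, hms⟩ := (Filter.mem_biInf_of_directed (f := id) hdir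
          ⟨OrderDual.ofDual y, hy⟩).1 (sInf_eq_iInf (α := Filter V) ▸ hs)
        obtain ⟨t, ht, hts⟩ := (hc hmc).2 s hms
        exact ⟨t, sInf_le (show m ∈ OrderDual.toDual ⁻¹' c from hmc) ht, hts⟩)
    (OrderDual.toDual l) ⟨hne, hl⟩
  exact ⟨OrderDual.ofDual m, hml, hm.prop.1, hm.prop.2,
    fun m' h h1 h2 => hm.le_of_ge (y := OrderDual.toDual m') ⟨h1, h2⟩ h⟩

/-- A minimal filter with a basis of affine subspaces contains a coset of every subspace of finite
codimension: the images of its affine members in the quotient have a smallest one, and any point of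
that image defines such a coset. -/
theorem HasAffineBasis.exists_mk'_mem {k : Type u} {V : Type v} [Field k] [AddCommGroup V]
    [Module k V] {m : Filter V} [hne : m.NeBot] (hm : HasAffineBasis k m)
    (hmin : ∀ m' ≤ m, m'.NeBot → HasAffineBasis k m' → m ≤ m') (W : Submodule k V)
    [FiniteDimensional k (V ⧸ W)] :
    ∃ p : V, (AffineSubspace.mk' p W : Set V) ∈ m := by
  obtain ⟨t₀, ht₀, hmin₀⟩ := exists_minimalFor_of_wellFoundedLT
    (fun t : AffineSubspace k V => (t : Set V) ∈ m)
    (fun t => Module.finrank k (t.direction.map W.mkQ))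
    (by obtain ⟨t, ht, -⟩ := hm _ Filter.univ_mem; exact ⟨t, ht⟩)
  obtain ⟨p, hp⟩ := hne.nonempty_of_mem ht₀
  have hmeet : ∀ s ∈ m, ∃ t : AffineSubspace k V, (t : Set V) ∈ m ∧ (t : Set V) ⊆ s ∧
      ((t : Set V) ∩ AffineSubspace.mk' p W).Nonempty := by
    intro s hs
    obtain ⟨t, ht, hts⟩ := hm _ (Filter.inter_mem hs ht₀)
    refine ⟨t, ht, fun x hx => (hts hx).1, ?_⟩
    have hle : t.direction.map W.mkQ ≤ t₀.direction.map W.mkQ :=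
      Submodule.map_mono (AffineSubspace.direction_le fun x hx => (hts hx).2)
    have heq := Submodule.eq_of_le_of_finrank_le hle (hmin₀ ht (Submodule.finrank_mono hle))
    obtain ⟨q, hq⟩ := hne.nonempty_of_mem ht
    have : W.mkQ (p - q) ∈ t₀.direction.map W.mkQ :=
      ⟨p - q, AffineSubspace.vsub_mem_direction hp (hts hq).2, rfl⟩
    rw [← heq] at this
    obtain ⟨v, hv, hvp⟩ := this
    refine ⟨v + q, AffineSubspace.vadd_mem_of_mem_direction hv hq, ?_⟩
    rw [SetLike.mem_coe, AffineSubspace.mem_mk', vsub_eq_sub,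
      show v + q - p = v - (p - q) by abel]
    exact (Submodule.Quotient.eq W).1 hvp
  refine ⟨p, hmin (m ⊓ Filter.principal (AffineSubspace.mk' p W)) inf_le_left ?_ ?_
    (Filter.mem_inf_of_right (Filter.mem_principal_self _))⟩
  · refine Filter.inf_principal_neBot_iff.2 fun s hs => ?_
    obtain ⟨t, -, hts, h⟩ := hmeet s hs
    exact h.mono (Set.inter_subset_inter_left _ hts)
  · intro s hs
    obtain ⟨t, ht, hts⟩ := hm _ (Filter.mem_inf_principal.1 hs)
    refine ⟨t ⊓ AffineSubspace.mk' p W, ?_, fun x hx => hts hx.1 hx.2⟩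
    exact Filter.inter_mem (Filter.mem_inf_of_left ht)
      (Filter.mem_inf_of_right (Filter.mem_principal_self _))

theorem isClosed_topJacobson (k : Type u) (A : Type v) [Field k] [Ring A] [Algebra k A]
    [TopologicalSpace A] : IsClosed (topJacobson k A : Set A) := by
  rw [topJacobson, Submodule.coe_sInf]
  exact isClosed_biInter fun M (hM : IsMaximalClosedLeftIdeal M) => hM.prop.1

namespace IsPseudocompactAlgebra

variable (k : Type u) {A : Type v} [Field k] [Ring A] [Algebra k A] [TopologicalSpace A]
  [IsPseudocompactAlgebra k A]

/-- A pseudocompact algebra is linearly compact: a filter with a basis of affine subspaces has a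
cluster point. -/
theorem exists_clusterPt {l : Filter A} (hl : HasAffineBasis k l) (hne : l.NeBot) :
    ∃ a, ClusterPt a l := by
  obtain ⟨m, hml, hm, hmb, hmin⟩ := exists_minimal_hasAffineBasis hl hne
  let := IsTopologicalAddGroup.rightUniformSpace A
  have : IsUniformAddGroup A := isUniformAddGroup_of_addCommGroup
  have : CompleteSpace A := IsPseudocompactAlgebra.complete (k := k)
  have hc : Cauchy m := by
    have hb := (hasBasis_nhds_zero (k := k) (A := A)).comap fun x : A × A => x.2 - x.1
    rw [← uniformity_eq_comap_nhds_zero A] at hb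
    refine hb.cauchy_iff.2 ?_
    refine ⟨hm, fun I _ => ?_⟩
    have : FiniteDimensional k (A ⧸ I.toIdeal.restrictScalars k) := I.finiteDimensional
    obtain ⟨p, hp⟩ := hmb.exists_mk'_mem hmin (I.toIdeal.restrictScalars k)
    refine ⟨_, hp, fun x hx y hy => ?_⟩
    have hx' : x - p ∈ I.toIdeal := hx
    have hy' : y - p ∈ I.toIdeal := hy
    simpa using I.toIdeal.sub_mem hy' hx'
  obtain ⟨a, ha⟩ := CompleteSpace.complete hc
  exact ⟨a, ClusterPt.mono (ClusterPt.of_le_nhds' ha hm) hml⟩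

/-- A directed family of nonempty closed affine subspaces of a pseudocompact algebra has a common
point. -/
theorem exists_forall_mem {ι : Type w} [Nonempty ι] (F : ι → AffineSubspace k A)
    (hdir : Directed (· ≥ ·) F) (hne : ∀ i, (F i : Set A).Nonempty)
    (hcl : ∀ i, IsClosed (F i : Set A)) : ∃ a, ∀ i, a ∈ F i := by
  have hd : Directed (· ≥ ·) fun i => Filter.principal (F i : Set A) :=
    fun i j => (hdir i j).imp fun l h => ⟨Filter.principal_mono.2 h.1, Filter.principal_mono.2 h.2⟩
  obtain ⟨a, ha⟩ := exists_clusterPt k (l := ⨅ i, Filter.principal (F i : Set A))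
    (fun s hs => by
      obtain ⟨i, hi⟩ := (Filter.mem_iInf_of_directed hd s).1 hs
      exact ⟨F i, Filter.mem_iInf_of_mem i (Filter.mem_principal_self _), hi⟩)
    (Filter.iInf_neBot_of_directed' hd fun i => Filter.principal_neBot_iff.2 (hne i))
  exact ⟨a, fun i => (hcl i).closure_subset
    (mem_closure_iff_clusterPt.2 (ha.mono (iInf_le _ i)))⟩

theorem exists_openIdeal_subset {s : Set A} (hs : s ∈ 𝓝 (0 : A)) :
    ∃ I : OpenIdeal k A, (I.toIdeal : Set A) ⊆ s := by
  simpa using (hasBasis_nhds_zero (k := k) (A := A)).mem_iff.1 hs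

instance : Nonempty (OpenIdeal k A) := (exists_openIdeal_subset k Filter.univ_mem).nonempty

/-- A family of nonempty closed affine subspaces indexed monotonically by the open ideals has a
common point. -/
theorem exists_forall_mem_of_mono (F : OpenIdeal k A → AffineSubspace k A)
    (hmono : ∀ I I', I.toIdeal ≤ I'.toIdeal → F I ≤ F I') (hne : ∀ I, (F I : Set A).Nonempty)
    (hcl : ∀ I, IsClosed (F I : Set A)) : ∃ a, ∀ I, a ∈ F I := by
  refine exists_forall_mem k F (fun I I' => ?_) hne hcl
  obtain ⟨I'', h⟩ := exists_openIdeal_subset k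
    (Filter.inter_mem (I.isOpen.mem_nhds I.toIdeal.zero_mem)
      (I'.isOpen.mem_nhds I'.toIdeal.zero_mem))
  exact ⟨I'', hmono _ _ fun x hx => (h hx).1, hmono _ _ fun x hx => (h hx).2⟩

variable {k}

theorem _root_.OpenIdeal.isOpen_of_le (I : OpenIdeal k A) {V : Submodule k A}
    (h : I.toIdeal.restrictScalars k ≤ V) : IsOpen (V : Set A) :=
  AddSubgroup.isOpen_mono (H₁ := I.toIdeal.toAddSubgroup) (H₂ := V.toAddSubgroup) h I.isOpen

theorem _root_.OpenIdeal.isClosed_of_le (I : OpenIdeal k A) {V : Submodule k A}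
    (h : I.toIdeal.restrictScalars k ≤ V) : IsClosed (V : Set A) :=
  AddSubgroup.isClosed_of_isOpen V.toAddSubgroup (I.isOpen_of_le h)

theorem mem_of_forall_mem_sup {V : Submodule k A} (hV : IsClosed (V : Set A)) {x : A}
    (hx : ∀ I : OpenIdeal k A, x ∈ V ⊔ I.toIdeal.restrictScalars k) : x ∈ V := by
  by_contra h
  have : (fun y => x - y) ⁻¹' (V : Set A)ᶜ ∈ 𝓝 (0 : A) :=
    (hV.isOpen_compl.preimage (continuous_const.sub continuous_id)).mem_nhds (by simpa using h)
  obtain ⟨I, hI⟩ := exists_openIdeal_subset k this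
  obtain ⟨v, hv, i, hi, rfl⟩ := Submodule.mem_sup.1 (hx I)
  exact hI hi (by simpa using hv)

/-- Sums of closed subspaces are closed, by linear compactness. -/
theorem isClosed_sup {V W : Submodule k A} (hV : IsClosed (V : Set A))
    (hW : IsClosed (W : Set A)) : IsClosed ((V ⊔ W : Submodule k A) : Set A) := by
  refine isClosed_of_closure_subset fun x hx => ?_
  have hx' : ∀ I : OpenIdeal k A, x ∈ V ⊔ (W ⊔ I.toIdeal.restrictScalars k) := fun I =>
    closure_minimal (s := ((V ⊔ W : Submodule k A) : Set A))
      (sup_le_sup_left le_sup_left V)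
      (I.isClosed_of_le (le_sup_right.trans le_sup_right)) hx
  let F (I : OpenIdeal k A) : AffineSubspace k A :=
    V.toAffineSubspace ⊓ AffineSubspace.mk' x (W ⊔ I.toIdeal.restrictScalars k)
  obtain ⟨v, hv⟩ := exists_forall_mem_of_mono k F
    (fun I I' h y hy => ⟨hy.1, sup_le_sup_left (c := W)
      (show I.toIdeal.restrictScalars k ≤ I'.toIdeal.restrictScalars k from h) hy.2⟩)
    (fun I => by
      obtain ⟨v, hv, w, hw, h⟩ := Submodule.mem_sup.1 (hx' I)
      exact ⟨v, hv, by simpa [← h] using hw⟩)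
    (fun I => hV.inter ((I.isClosed_of_le le_sup_right).preimage (f := fun y => y - x)
      (continuous_id.sub continuous_const)))
  have hvV : v ∈ V := (hv (Classical.arbitrary _)).1
  have hvW : v - x ∈ W := mem_of_forall_mem_sup hW fun I => (hv I).2
  have := sub_mem (Submodule.mem_sup_left (T := W) hvV) (Submodule.mem_sup_right (S := V) hvW)
  simpa using this

/-- A closed subspace of finite codimension is open. -/
theorem isOpen_of_isClosed_of_finiteDimensional {V : Submodule k A} (hV : IsClosed (V : Set A))
    [FiniteDimensional k (A ⧸ V)] : IsOpen (V : Set A) := by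
  obtain ⟨I, hI⟩ := exists_minimalFor_of_wellFoundedLT (fun _ : OpenIdeal k A => True)
    (fun I => Module.finrank k ((I.toIdeal.restrictScalars k).map V.mkQ))
    ⟨Classical.arbitrary _, trivial⟩
  -- `I` has the smallest image in `A/V`, so that this image is contained in that of any other `I'`
  refine I.isOpen_of_le fun x hx => mem_of_forall_mem_sup hV fun I' => ?_
  obtain ⟨I'', h⟩ := exists_openIdeal_subset k
    (Filter.inter_mem (I.isOpen.mem_nhds I.toIdeal.zero_mem)
      (I'.isOpen.mem_nhds I'.toIdeal.zero_mem))
  have hle : (I''.toIdeal.restrictScalars k).map V.mkQ ≤ (I.toIdeal.restrictScalars k).map V.mkQ :=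
    Submodule.map_mono fun y hy => (h hy).1
  have heq := Submodule.eq_of_le_of_finrank_le hle (hI.2 trivial (Submodule.finrank_mono hle))
  obtain ⟨y, hy, hyx⟩ : V.mkQ x ∈ (I''.toIdeal.restrictScalars k).map V.mkQ :=
    heq ▸ Submodule.mem_map_of_mem hx
  have hV' : x - y ∈ V := (Submodule.Quotient.eq V).1 hyx.symm
  have := add_mem (Submodule.mem_sup_left (T := I'.toIdeal.restrictScalars k) hV')
    (Submodule.mem_sup_right (S := V) (h hy).2)
  simpa using this

/-- The equations `x * (1 - ω) = 1` modulo the open ideals are solvable, because an open left ideal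
containing `1 - ω` would lie in a maximal closed one; linear compactness gives a common solution. -/
theorem exists_mul_one_sub_eq_one {ω : A} (hω : ω ∈ topJacobson k A) :
    ∃ x, x * (1 - ω) = 1 := by
  have hI : ∀ I : OpenIdeal k A, ∃ x, x * (1 - ω) - 1 ∈ I.toIdeal := by
    intro I
    by_contra! hne
    obtain ⟨M, hM, hle⟩ := Ideal.exists_le_maximal (Ideal.span {1 - ω} ⊔ I.toIdeal) (by
      intro h
      obtain ⟨y, hy, i, hi, h1⟩ := Submodule.mem_sup.1 ((Ideal.eq_top_iff_one _).1 h)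
      obtain ⟨x, rfl⟩ := Ideal.mem_span_singleton'.1 hy
      refine hne x ?_
      rw [show x * (1 - ω) - 1 = -i by nth_rw 2 [← h1]; abel]
      exact I.toIdeal.neg_mem hi)
    have hcl : IsClosed (M : Set A) :=
      I.isClosed_of_le (V := M.restrictScalars k) fun _ hx => hle (Ideal.mem_sup_right hx)
    have hMmax : IsMaximalClosedLeftIdeal M :=
      ⟨⟨hcl, hM.ne_top⟩, fun L hL h => (hM.eq_of_le hL.2 h).ge⟩
    have h1 : ω ∈ M := Submodule.mem_sInf.1 hω M hMmax
    have h2 : 1 - ω ∈ M := hle (Ideal.mem_sup_left (Ideal.mem_span_singleton_self _))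
    exact hM.ne_top ((Ideal.eq_top_iff_one M).2 (by simpa using M.add_mem h2 h1))
  let F (I : OpenIdeal k A) : AffineSubspace k A :=
    (AffineSubspace.mk' 1 (I.toIdeal.restrictScalars k)).comap
      (LinearMap.mulRight k (1 - ω)).toAffineMap
  have hF : ∀ I x, x ∈ F I ↔ x * (1 - ω) - 1 ∈ I.toIdeal := fun I y => Iff.rfl
  obtain ⟨x, hx⟩ := exists_forall_mem_of_mono k F (fun I I' h y hy => h hy) hI
    (fun I => (I.isClosed_of_le (V := I.toIdeal.restrictScalars k) le_rfl).preimage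
      (f := fun y => y * (1 - ω) - 1) (by
        exact (continuous_id.mul continuous_const).sub continuous_const))
  refine ⟨x, sub_eq_zero.1 ?_⟩
  have : x * (1 - ω) - 1 ∈ (⨅ I : OpenIdeal k A, I.toIdeal) :=
    (Submodule.mem_iInf _).2 fun I => (hF I x).1 (hx I)
  rwa [iInf_openIdeal_eq_bot] at this

theorem isUnit_one_sub {ω : A} (hω : ω ∈ topJacobson k A) : IsUnit (1 - ω) := by
  obtain ⟨x, hx⟩ := exists_mul_one_sub_eq_one hω
  -- the left inverse `x` is again of the form `1 - ω'` with `ω' ∈ J`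
  obtain ⟨y, hy⟩ := exists_mul_one_sub_eq_one (k := k) (ω := -(x * ω))
    (neg_mem (Ideal.mul_mem_left _ x hω))
  have h1 : 1 - -(x * ω) = x := by
    rw [mul_sub, mul_one, sub_eq_iff_eq_add] at hx
    rw [sub_neg_eq_add, ← hx]
  rw [h1] at hy
  have h2 : y = 1 - ω := left_inv_eq_right_inv hy hx
  exact ⟨⟨1 - ω, x, h2 ▸ hy, hx⟩, rfl⟩

end IsPseudocompactAlgebra

/-! ### Quotients of separable algebras -/

/-- The quotient of a topologically semisimple ring by an open two-sided ideal is semisimple. -/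
theorem IsTopologicallySemisimple.isSemisimpleRing_of_surjective {R : Type v} {S : Type w} [Ring R]
    [TopologicalSpace R] [Ring S] (h : IsTopologicallySemisimple R) (f : R →+* S)
    (hf : Function.Surjective f) (hcl : ∀ s : Set S, IsClosed (f ⁻¹' s)) : IsSemisimpleRing S := by
  refine (isSemisimpleModule_iff S S).2 ⟨fun (L : Ideal S) => ?_⟩
  obtain ⟨N, -, hN⟩ := h (L.comap f) (hcl L)
  refine ⟨Ideal.map f N, ⟨Submodule.disjoint_def.2 fun x hx hxN => ?_, ?_⟩⟩
  · obtain ⟨n, hn, rfl⟩ := (Ideal.mem_map_iff_of_surjective f hf).1 hxN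
    rw [Submodule.disjoint_def.1 hN.disjoint n hx hn, map_zero]
  · rw [codisjoint_iff, ← Ideal.map_comap_of_surjective f hf L]
    have h1 := congrArg (Ideal.map f) hN.sup_eq_top
    rwa [Ideal.map_sup, Ideal.map_top] at h1

namespace CompletedTensor

variable (k : Type u) (A : Type v) (B : Type w) [Field k] [Ring A] [Algebra k A]
  [TopologicalSpace A] [Ring B] [Algebra k B] [TopologicalSpace B]

/-- The projection of the completed tensor product to `A/I ⊗ B/K`. -/
noncomputable def proj (p : OpenIdeal k A × OpenIdeal k B) :
    CompletedTensor k A B →+* (A ⧸ p.1.toIdeal) ⊗[k] (B ⧸ p.2.toIdeal) :=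
  (Pi.evalRingHom _ p).comp (completedTensorSubalgebra k A B).val.toRingHom

theorem proj_surjective (p : OpenIdeal k A × OpenIdeal k B) :
    Function.Surjective (proj k A B p) := by
  let φ (q : OpenIdeal k A × OpenIdeal k B) :
      A ⊗[k] B →ₐ[k] (A ⧸ q.1.toIdeal) ⊗[k] (B ⧸ q.2.toIdeal) :=
    Algebra.TensorProduct.map (Ideal.Quotient.mkₐ k q.1.toIdeal) (Ideal.Quotient.mkₐ k q.2.toIdeal)
  intro x
  obtain ⟨t, rfl⟩ : ∃ t, φ p t = x := TensorProduct.map_surjective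
    (Ideal.Quotient.mkₐ_surjective k p.1.toIdeal) (Ideal.Quotient.mkₐ_surjective k p.2.toIdeal) x
  refine ⟨⟨fun q => φ q t, fun q q' h h' => ?_⟩, rfl⟩
  have : (OpenIdeal.tensorTransition h h').comp (φ q) = φ q' := by
    ext <;> simp [φ, OpenIdeal.tensorTransition]
  exact AlgHom.congr_fun this t

theorem isClosed_preimage_proj (p : OpenIdeal k A × OpenIdeal k B)
    (s : Set ((A ⧸ p.1.toIdeal) ⊗[k] (B ⧸ p.2.toIdeal))) : IsClosed (proj k A B p ⁻¹' s) := by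
  let (q : OpenIdeal k A × OpenIdeal k B) :
    TopologicalSpace ((A ⧸ q.1.toIdeal) ⊗[k] (B ⧸ q.2.toIdeal)) := ⊥
  have : DiscreteTopology ((A ⧸ p.1.toIdeal) ⊗[k] (B ⧸ p.2.toIdeal)) := ⟨rfl⟩
  have hc : Continuous (proj k A B p) :=
    (continuous_apply (A := fun q : OpenIdeal k A × OpenIdeal k B =>
      (A ⧸ q.1.toIdeal) ⊗[k] (B ⧸ q.2.toIdeal)) p).comp continuous_induced_dom
  exact (isClosed_discrete s).preimage hc

end CompletedTensor

/-- A finite-dimensional discrete quotient of a separable algebra has a separability idempotent. -/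
theorem IsSeparablePseudocompact.exists_isSeparabilityIdempotent {k : Type u} {B : Type v}
    [Field k] [Ring B] [Algebra k B] [TopologicalSpace B] (h : IsSeparablePseudocompact k B)
    (I : OpenIdeal k B) :
    ∃ e : (B ⧸ I.toIdeal) ⊗[k] (B ⧸ I.toIdeal), IsSeparabilityIdempotent k e := by
  have := I.finiteDimensional
  refine _root_.exists_isSeparabilityIdempotent k _ fun E _ _ _ => ?_
  let : TopologicalSpace E := ⊥
  have : DiscreteTopology E := ⟨rfl⟩
  let Z : OpenIdeal k E := ⟨⊥, inferInstance, isOpen_discrete _, inferInstance⟩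
  have hs := (h E).isSemisimpleRing_of_surjective (CompletedTensor.proj k B E (I, Z))
    (CompletedTensor.proj_surjective k B E _) (CompletedTensor.isClosed_preimage_proj k B E _)
  let f : (B ⧸ I.toIdeal) ⊗[k] (E ⧸ Z.toIdeal) ≃ₐ[k] E ⊗[k] (B ⧸ I.toIdeal) :=
    (Algebra.TensorProduct.congr AlgEquiv.refl (AlgEquiv.quotientBot k E)).trans
      (Algebra.TensorProduct.comm k _ _)
  exact f.toRingEquiv.isSemisimpleRing

/-! ### Intertwiners -/

/-- Two homomorphisms `f, g : B → C` out of an algebra with a separability idempotent are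
intertwined by the image of that idempotent under `x ⊗ y ↦ f x * g y`; wherever `f` and `g` become
equal, that image becomes `1`. -/
theorem IsSeparabilityIdempotent.exists_intertwiner {k : Type u} {B : Type v} {C : Type w}
    [CommRing k] [Ring B] [Algebra k B] [Ring C] [Algebra k C] {e : B ⊗[k] B}
    (he : IsSeparabilityIdempotent k e) (f g : B →ₐ[k] C) (N : Ideal C) [N.IsTwoSided]
    (hN : ∀ b, f b - g b ∈ N) : ∃ c : C, c - 1 ∈ N ∧ ∀ b, f b * c = c * g b := by
  let Φ : B ⊗[k] B →ₗ[k] C := LinearMap.mul' k C ∘ₗ TensorProduct.map f.toLinearMap g.toLinearMap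
  refine ⟨Φ e, ?_, fun b => ?_⟩
  · have h : ∀ t : B ⊗[k] B, Φ t - f (LinearMap.mul' k B t) ∈ N := by
      intro t
      induction t using TensorProduct.induction_on with
      | zero => simp
      | add x y hx hy =>
        rw [map_add, map_add, map_add, add_sub_add_comm]
        exact N.add_mem hx hy
      | tmul x y =>
        have : Φ (x ⊗ₜ y) - f (LinearMap.mul' k B (x ⊗ₜ y)) = -(f x * (f y - g y)) := by
          simp [Φ, mul_sub]
        rw [this]
        exact N.neg_mem (N.mul_mem_left _ (hN y))
    simpa [he.mul'_eq_one] using h e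
  · have hl : ∀ t : B ⊗[k] B, f b * Φ t = Φ ((LinearMap.mulLeft k b).rTensor B t) := by
      intro t
      induction t using TensorProduct.induction_on with
      | zero => simp
      | add x y hx hy => simp only [map_add, mul_add, hx, hy]
      | tmul x y => simp [Φ, mul_assoc]
    have hr : ∀ t : B ⊗[k] B, Φ t * g b = Φ ((LinearMap.mulRight k b).lTensor B t) := by
      intro t
      induction t using TensorProduct.induction_on with
      | zero => simp
      | add x y hx hy => simp only [map_add, add_mul, hx, hy]
      | tmul x y => simp [Φ, mul_assoc]
    rw [hl, hr, he.rTensor_eq_lTensor]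

/-! ### Sections of the projection to `A/J` -/

namespace IsPseudocompactAlgebra

variable {k : Type u} {A : Type v} [Field k] [Ring A] [Algebra k A] [TopologicalSpace A]
  [IsPseudocompactAlgebra k A]

/-- The section of `A → A/J` with image a closed complement `S` of `J` is continuous: the preimage
of an open ideal `I` pulls back to the closed subspace `(S ∩ I) + J` of finite codimension in
`A`. -/
theorem exists_section (S : Subalgebra k A) (hScl : IsClosed (S : Set A))
    (hS : IsCompl (Subalgebra.toSubmodule S) ((topJacobson k A).restrictScalars k)) :
    ∃ σ : (A ⧸ topJacobson k A) →ₐ[k] A, σ.range = S ∧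
      (∀ x, Ideal.Quotient.mk (topJacobson k A) (σ x) = x) ∧
      ∀ I : OpenIdeal k A, IsOpen (σ ⁻¹' (I.toIdeal : Set A)) := by
  let q := Ideal.Quotient.mkₐ k (topJacobson k A)
  have hq : ∀ x, q x = 0 ↔ x ∈ topJacobson k A := fun x => Ideal.Quotient.eq_zero_iff_mem
  have hbij : Function.Bijective (q.comp S.val) := by
    refine ⟨(injective_iff_map_eq_zero _).2 fun s hs => ?_, fun x => ?_⟩
    · exact Subtype.ext (Submodule.disjoint_def.1 hS.disjoint s s.2 ((hq s).1 hs))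
    · obtain ⟨a, rfl⟩ := Ideal.Quotient.mk_surjective x
      obtain ⟨s, hs, j, hj, rfl⟩ := Submodule.mem_sup.1
        (hS.sup_eq_top ▸ Submodule.mem_top : a ∈ _)
      refine ⟨⟨s, hs⟩, ?_⟩
      rw [map_add, Ideal.Quotient.eq_zero_iff_mem.2 hj, add_zero]
      rfl
  let E := AlgEquiv.ofBijective _ hbij
  have hqE : ∀ x, q (E.symm x) = x := fun x => E.apply_symm_apply x
  refine ⟨S.val.comp E.symm.toAlgHom, ?_, hqE, fun I => ?_⟩
  · ext a
    constructor
    · rintro ⟨x, rfl⟩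
      exact (E.symm x).2
    · exact fun ha => ⟨E ⟨a, ha⟩, congrArg Subtype.val (E.symm_apply_apply _)⟩
  let V : Submodule k A := (Subalgebra.toSubmodule S ⊓ I.toIdeal.restrictScalars k) ⊔
    (topJacobson k A).restrictScalars k
  have hV : ∀ a, a ∈ V ↔ ((E.symm (q a) : S) : A) ∈ I.toIdeal := by
    intro a
    have hd : a - E.symm (q a) ∈ topJacobson k A := by rw [← hq, map_sub, hqE, sub_self]
    constructor
    · intro ha
      obtain ⟨s, ⟨hs, hsI⟩, j, hj, rfl⟩ := Submodule.mem_sup.1 ha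
      have : q (s + j) = E ⟨s, hs⟩ := by
        rw [map_add, (hq j).2 hj, add_zero]
        rfl
      rw [this, E.symm_apply_apply]
      exact hsI
    · intro ha
      exact Submodule.mem_sup.2 ⟨_, ⟨(E.symm (q a)).2, ha⟩, _, hd, add_sub_cancel _ _⟩
  have hVcl : IsClosed (V : Set A) :=
    isClosed_sup (hScl.inter (I.isClosed_of_le (V := I.toIdeal.restrictScalars k) le_rfl))
      (isClosed_topJacobson k A)
  have hVfin : FiniteDimensional k (A ⧸ V) := by
    have := I.finiteDimensional
    let g : A →ₗ[k] A ⧸ I.toIdeal :=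
      ((Ideal.Quotient.mkₐ k I.toIdeal).comp ((S.val.comp E.symm.toAlgHom).comp q)).toLinearMap
    have hg : V = LinearMap.ker g := by
      ext a
      rw [hV, LinearMap.mem_ker]
      exact Ideal.Quotient.eq_zero_iff_mem.symm
    rw [hg]
    exact g.quotKerEquivRange.symm.finiteDimensional
  have hVo := isOpen_of_isClosed_of_finiteDimensional hVcl
  refine (isQuotientMap_quot_mk (X := A)).isOpen_preimage.1 ?_
  convert hVo using 1
  ext a
  exact (hV a).symm

/-- Two continuous sections `σ, τ` of `A → A/J` are intertwined by an element of `1 + J`. Modulo an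
open ideal `I` both factor through one finite-dimensional quotient of `A/J`, whose separability
idempotent gives an intertwiner; the intertwiners modulo `I` form closed affine subspaces, so by
linear compactness there is one for all `I` at once. -/
theorem exists_intertwiner (hsep : IsSeparablePseudocompact k (A ⧸ topJacobson k A))
    (σ τ : (A ⧸ topJacobson k A) →ₐ[k] A)
    (hσ : ∀ x, Ideal.Quotient.mk (topJacobson k A) (σ x) = x)
    (hτ : ∀ x, Ideal.Quotient.mk (topJacobson k A) (τ x) = x)
    (hσo : ∀ I : OpenIdeal k A, IsOpen (σ ⁻¹' (I.toIdeal : Set A)))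
    (hτo : ∀ I : OpenIdeal k A, IsOpen (τ ⁻¹' (I.toIdeal : Set A))) :
    ∃ c : A, c - 1 ∈ topJacobson k A ∧ ∀ x, σ x * c = c * τ x := by
  have hI : ∀ I : OpenIdeal k A, ∃ c : A, c - 1 ∈ topJacobson k A ∧
      ∀ x, σ x * c - c * τ x ∈ I.toIdeal := by
    intro I
    have := I.finiteDimensional
    let π := Ideal.Quotient.mkₐ k I.toIdeal
    -- the homomorphism `(σ, τ)` modulo `I`, whose kernel `K` is open of finite codimension
    let στ : (A ⧸ topJacobson k A) →ₐ[k] (A ⧸ I.toIdeal) × (A ⧸ I.toIdeal) :=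
      (π.comp σ).prod (π.comp τ)
    have hker : ∀ x, x ∈ RingHom.ker στ ↔ σ x ∈ I.toIdeal ∧ τ x ∈ I.toIdeal := fun x => by
      rw [RingHom.mem_ker, ← Ideal.Quotient.eq_zero_iff_mem, ← Ideal.Quotient.eq_zero_iff_mem]
      exact Prod.ext_iff
    let K : OpenIdeal k (A ⧸ topJacobson k A) :=
      { toIdeal := RingHom.ker στ
        isTwoSided := inferInstance
        isOpen := by
          convert (hσo I).inter (hτo I)
          ext x
          exact hker x
        finiteDimensional := (Ideal.quotientKerEquivRange στ).symm.toLinearEquiv.finiteDimensional }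
    obtain ⟨e, he⟩ := hsep.exists_isSeparabilityIdempotent K
    let f : (A ⧸ topJacobson k A) ⧸ K.toIdeal →ₐ[k] A ⧸ I.toIdeal :=
      Ideal.Quotient.liftₐ K.toIdeal (π.comp σ) fun x hx =>
        Ideal.Quotient.eq_zero_iff_mem.2 ((hker x).1 hx).1
    let g : (A ⧸ topJacobson k A) ⧸ K.toIdeal →ₐ[k] A ⧸ I.toIdeal :=
      Ideal.Quotient.liftₐ K.toIdeal (π.comp τ) fun x hx =>
        Ideal.Quotient.eq_zero_iff_mem.2 ((hker x).1 hx).2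
    have hπ : Function.Surjective π := Ideal.Quotient.mk_surjective
    let N : Ideal (A ⧸ I.toIdeal) := (topJacobson k A).map π
    have hN : N.IsTwoSided := by
      refine ⟨fun {a} b ha => ?_⟩
      obtain ⟨a, haJ, rfl⟩ := (Ideal.mem_map_iff_of_surjective π hπ).1 ha
      obtain ⟨b, rfl⟩ := hπ b
      rw [← map_mul]
      exact Ideal.mem_map_of_mem π (Ideal.mul_mem_right b _ haJ)
    obtain ⟨c, hcN, hc⟩ := he.exists_intertwiner f g N (by
      intro b
      obtain ⟨x, rfl⟩ := Ideal.Quotient.mk_surjective b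
      change π (σ x) - π (τ x) ∈ N
      rw [← map_sub]
      refine Ideal.mem_map_of_mem π ?_
      rw [← Ideal.Quotient.eq_zero_iff_mem, map_sub, hσ, hτ, sub_self])
    obtain ⟨j, hj, hjc⟩ := (Ideal.mem_map_iff_of_surjective π hπ).1 hcN
    refine ⟨1 + j, by simpa using hj, fun x => ?_⟩
    have hc' : π (1 + j) = c := by rw [map_add, map_one, hjc, add_sub_cancel]
    rw [← Ideal.Quotient.eq_zero_iff_mem]
    change π _ = 0
    rw [map_sub, map_mul, map_mul, hc', sub_eq_zero]
    exact hc (Ideal.Quotient.mk K.toIdeal x)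
  let d (x : A ⧸ topJacobson k A) : A →ₗ[k] A :=
    LinearMap.mulLeft k (σ x) - LinearMap.mulRight k (τ x)
  let F (I : OpenIdeal k A) : AffineSubspace k A :=
    AffineSubspace.mk' 1 ((topJacobson k A).restrictScalars k) ⊓
      (⨅ x, (I.toIdeal.restrictScalars k).comap (d x) : Submodule k A).toAffineSubspace
  have hF : ∀ I c, c ∈ F I ↔ c - 1 ∈ topJacobson k A ∧ ∀ x, σ x * c - c * τ x ∈ I.toIdeal :=
    fun I c => and_congr Iff.rfl (Submodule.mem_iInf _)
  obtain ⟨c, hc⟩ := exists_forall_mem_of_mono k F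
    (fun I I' h c hc => (hF I' c).2 ⟨((hF I c).1 hc).1, fun x => h (((hF I c).1 hc).2 x)⟩)
    (fun I => (hI I).imp fun c => (hF I c).2)
    (fun I => by
      have : (F I : Set A) = (fun c => c - 1) ⁻¹' (topJacobson k A : Set A) ∩
          ⋂ x, (fun c => σ x * c - c * τ x) ⁻¹' (I.toIdeal : Set A) := by
        ext c
        simpa using hF I c
      rw [this]
      refine ((isClosed_topJacobson k A).preimage (continuous_id.sub continuous_const)).inter
        (isClosed_iInter fun x => ?_)
      exact (I.isClosed_of_le (V := I.toIdeal.restrictScalars k) le_rfl).preimage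
        ((continuous_const.mul continuous_id).sub (continuous_id.mul continuous_const)))
  refine ⟨c, ((hF (Classical.arbitrary _) c).1 (hc _)).1, fun x => sub_eq_zero.1 ?_⟩
  have : σ x * c - c * τ x ∈ (⨅ I : OpenIdeal k A, I.toIdeal) :=
    (Submodule.mem_iInf _).2 fun I => ((hF I c).1 (hc I)).2 x
  rwa [iInf_openIdeal_eq_bot] at this

end IsPseudocompactAlgebra

/-! ### Conjugacy of complements of the radical -/

theorem mainTheorem2 {k : Type u} {A : Type v} [Field k] [Ring A] [Algebra k A]
    [TopologicalSpace A] [IsPseudocompactAlgebra k A]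
    (hsep : IsSeparablePseudocompact k (A ⧸ topJacobson k A))
    (S₁ S₂ : Subalgebra k A)
    (hS₁_closed : IsClosed (S₁ : Set A)) (hS₂_closed : IsClosed (S₂ : Set A))
    (hS₁ : IsCompl (Subalgebra.toSubmodule S₁) ((topJacobson k A).restrictScalars k))
    (hS₂ : IsCompl (Subalgebra.toSubmodule S₂) ((topJacobson k A).restrictScalars k)) :
    ∃ ω ∈ topJacobson k A, ∃ c : Aˣ, (c : A) = 1 - ω ∧
      (S₁ : Set A) = (fun s : A => (c : A) * s * ((c⁻¹ : Aˣ) : A)) '' (S₂ : Set A) := by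
  obtain ⟨σ, rfl, hσ, hσo⟩ := IsPseudocompactAlgebra.exists_section S₁ hS₁_closed hS₁
  obtain ⟨τ, rfl, hτ, hτo⟩ := IsPseudocompactAlgebra.exists_section S₂ hS₂_closed hS₂
  obtain ⟨a, haJ, ha⟩ := IsPseudocompactAlgebra.exists_intertwiner hsep σ τ hσ hτ hσo hτo
  have hω : 1 - a ∈ topJacobson k A := by simpa using neg_mem haJ
  obtain ⟨c, hc⟩ := IsPseudocompactAlgebra.isUnit_one_sub hω
  have hca : (c : A) = a := by simpa using hc
  refine ⟨1 - a, hω, c, hc, ?_⟩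
  have hconj : ∀ x, (c : A) * τ x * ((c⁻¹ : Aˣ) : A) = σ x := fun x => by
    rw [Units.mul_inv_eq_iff_eq_mul, hca, ha]
  ext y
  constructor
  · rintro ⟨x, rfl⟩
    exact ⟨τ x, ⟨x, rfl⟩, hconj x⟩
  · rintro ⟨_, ⟨x, rfl⟩, rfl⟩
    exact ⟨x, (hconj x).symm⟩
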